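/- Let $\alpha>0$ and let $(S_1,\mu_1)$, $(S_2,\mu_2)$ be measure spaces with $\mu_1$ $\sigma$-finite. $L^\alpha_+(S,\mu)$ denotes the set of measurable $f:S\to[0,\infty)$ with $\|f\|^\alpha:=\int f^\alpha\,d\mu<\infty$, equipped with the metric $\int|f^\alpha-g^\alpha|\,d\mu$; functions, and sets, that agree almost everywhere are identified. A max-linear subspace $\mathcal F$ is a subset of $L^\alpha_+$ that is closed in this metric and such that $af\vee bg\in\mathcal F$ for all $f,g\in\mathcal F$, $a,b>0$. A max-linear isometry is a map $U$ into $L^\alpha_+(S_2,\mu_2)$ with $U(af\vee bg)=aUf\vee bUg$ a.e. for all $f,g$ in its domain and $a,b\ge0$, and $\|Uf\|=\|f\|$. We write $\mathrm{supp}(\mathcal F)=\mathrm{supp}(f_0)=\{f_0\ne0\}$ if $f_0\in\mathcal F$ and $\mathrm{supp}(g)\subset\mathrm{supp}(f_0)$ mod $\mu$ for all $g\in\mathcal F$. The ratio $\sigma$-field $\rho(\mathcal F)$ is the $\sigma$-field generated by the $[0,\infty]$-valued ratios $f/g$, $f,g\in\mathcal F$ (with $0/0=0$), and $\mathcal R_{e,+}(\mathcal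 F)$ is the class of all functions in $L^\alpha_+(S,\mu)$ of the form $rf$ with $f\in\mathcal F$ and $r:S\to[0,\infty)$ $\rho(\mathcal F)$-measurable. A regular set isomorphism between $\sigma$-fields $\mathcal A_1,\mathcal A_2$ on $S_1,S_2$ is a map $T:\mathcal A_1\to\mathcal A_2$ such that, mod $\mu_2$, $T(S_1\setminus A)=T(S_1)\setminus T(A)$ and $T(\bigcup_n A_n)=\bigcup_n T(A_n)$ for disjoint $A_n$, and such that $\mu_2(T(A))=0$ if and only if $\mu_1(A)=0$. Let $\mathcal F$ be a max-linear subspace of $L^\alpha_+(S_1,\mu_1)$ with $\mathrm{supp}(\mathcal F)=S_1$ mod $\mu_1$, and let $U:\mathcal F\to L^\alpha_+(S_2,\mu_2)$ be a max-linear isometry. Then: (i) $U$ has an extension to a max-linear isometry $\overline U:\mathcal R_{e,+}(\mathcal F)\to L^\alpha_+(S_2,\mu_2)$, and this extension is unique (modulo $\mu_2$-null sets). The image of $\overline U$ is $\mathcal R_{e,+}(U(\mathcal F))$. Moreover $\mathrm{supp}(U(\mathcal F))$ exists and there is a regular set isomorphism $T:\rho(\mathcal F)\to\rho(U(\mathcal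 F))$ with $T(S_1)=\mathrm{supp}(U(\mathcal F))$ mod $\mu_2$, mapping $\rho(\mathcal F)$ onto the trace of $\rho(U(\mathcal F))$ on $\mathrm{supp}(U(\mathcal F))$ (mod $\mu_2$), such that $$\overline U(rf)=(Tr)(Uf)\quad\mu_2\text{-a.e.}$$ for all $f\in\mathcal F$ and all $\rho(\mathcal F)$-measurable $r:S_1\to[0,\infty)$ with $rf\in L^\alpha_+(S_1,\mu_1)$. Here $Tr:S_2\to[0,\infty)$ is the $\rho(U(\mathcal F))$-measurable function induced by $T$, that is, $\{Tr\in B\}\cap T(S_1)=T\{r\in B\}$ mod $\mu_2$ for all Borel sets $B$, and $Tr=0$ a.e. outside $T(S_1)$. (ii) For every $f\in\mathcal F$, $(Uf)^\alpha\,d\mu_2=(f^\alpha\,d\mu_1)\circ T^{-1}$ on $\rho(U(\mathcal F))$; that is, $\int_B(Uf)^\alpha\,d\mu_2=\int_A f^\alpha\,d\mu_1$ whenever $B\in\rho(U(\mathcal F))$, $A\in\rho(\mathcal F)$ and $T(A)=B\cap\mathrm{supp}(U(\mathcal F))$ mod $\mu_2$. -/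

import Mathlib

open MeasureTheory Set
open scoped ENNReal NNReal

/-- `L^α_+(S, μ)`: measurable `f : S → [0, ∞)` with `∫ f^α dμ < ∞`. Elements are functions;
identification modulo null sets is made explicit wherever it matters. -/
def LPlus {S : Type*} [MeasurableSpace S] (α : ℝ) (μ : Measure S) : Set (S → ℝ≥0) :=
  {f | Measurable f ∧ ∫⁻ s, (f s : ℝ≥0∞) ^ α ∂μ < ∞}

/-- The functional `‖f‖ = (∫ f^α dμ)^{1/α}`. -/
noncomputable def normPlus {S : Type*} [MeasurableSpace S] (α : ℝ) (μ : Measure S)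
    (f : S → ℝ≥0) : ℝ≥0∞ :=
  (∫⁻ s, (f s : ℝ≥0∞) ^ α ∂μ) ^ (1 / α)

/-- The (pseudo-)metric `∫ |f^α - g^α| dμ` on `L^α_+(S, μ)`. -/
noncomputable def distPlus {S : Type*} [MeasurableSpace S] (α : ℝ) (μ : Measure S)
    (f g : S → ℝ≥0) : ℝ≥0∞ :=
  ∫⁻ s, ENNReal.ofReal |(f s : ℝ) ^ α - (g s : ℝ) ^ α| ∂μ

/-- Max-linear subspace of `L^α_+(S, μ)`: stable under `a f ∨ b g` with `a, b > 0`, and closed in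
the metric `distPlus` (in particular stable under modification on null sets). -/
structure IsMaxLinearSubspace {S : Type*} [MeasurableSpace S] (α : ℝ) (μ : Measure S)
    (F : Set (S → ℝ≥0)) : Prop where
  subset : F ⊆ LPlus α μ
  max_mem : ∀ f ∈ F, ∀ g ∈ F, ∀ a b : ℝ≥0, 0 < a → 0 < b →
    (fun s => max (a * f s) (b * g s)) ∈ F
  closed : ∀ f ∈ LPlus α μ, (∀ ε : ℝ≥0∞, 0 < ε → ∃ g ∈ F, distPlus α μ g f < ε) → f ∈ F

/-- `V`, restricted to `D ⊆ L^α_+(S₁, μ₁)`, is a max-linear isometry into `L^α_+(S₂, μ₂)`. The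
values of `V` outside `D` are irrelevant for the sets `D` stable under `a f ∨ b g`,
`a, b ≥ 0`. -/
structure IsMaxLinearIsometryOn {S₁ S₂ : Type*} [MeasurableSpace S₁] [MeasurableSpace S₂]
    (α : ℝ) (μ₁ : Measure S₁) (μ₂ : Measure S₂) (D : Set (S₁ → ℝ≥0))
    (V : (S₁ → ℝ≥0) → (S₂ → ℝ≥0)) : Prop where
  mapsTo : ∀ f ∈ D, V f ∈ LPlus α μ₂
  map_max : ∀ f ∈ D, ∀ g ∈ D, ∀ a b : ℝ≥0,
    V (fun s => max (a * f s) (b * g s)) =ᵐ[μ₂] fun t => max (a * V f t) (b * V g t)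
  norm_eq : ∀ f ∈ D, normPlus α μ₂ (V f) = normPlus α μ₁ f

/-- `f₀` has full support with respect to `F`. -/
def HasFullSupport {S : Type*} [MeasurableSpace S] (μ : Measure S) (F : Set (S → ℝ≥0))
    (f₀ : S → ℝ≥0) : Prop :=
  Measurable f₀ ∧ ∀ g ∈ F, μ (Function.support g \ Function.support f₀) = 0

/-- `supp(F) = A` modulo `μ`: some `f₀ ∈ F` has full support with respect to `F`, and `A` is its
support up to a null set. -/
def SuppEq {S : Type*} [MeasurableSpace S] (μ : Measure S) (F : Set (S → ℝ≥0))
    (A : Set S) : Prop :=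
  ∃ f₀ ∈ F, HasFullSupport μ F f₀ ∧ A =ᵐ[μ] Function.support f₀

/-- The ratio σ-field `ρ(F)`, generated by the `[0, ∞]`-valued ratios `f / g`, `f, g ∈ F`
(with `a / 0 = ∞` for `a > 0` and `0 / 0 = 0`). -/
@[reducible] noncomputable def ratioSigma {S : Type*} (F : Set (S → ℝ≥0)) : MeasurableSpace S :=
  ⨆ f ∈ F, ⨆ g ∈ F,
    MeasurableSpace.comap (fun s => (f s : ℝ≥0∞) / (g s : ℝ≥0∞)) (borel ℝ≥0∞)

/-- The extended positive ratio space `R_{e,+}(F)`: all `r f` in `L^α_+(S, μ)` with `f ∈ F` and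
`r ≥ 0` a `ρ(F)`-measurable function. -/
def extRatioSpace {S : Type*} [MeasurableSpace S] (α : ℝ) (μ : Measure S)
    (F : Set (S → ℝ≥0)) : Set (S → ℝ≥0) :=
  {h | h ∈ LPlus α μ ∧
    ∃ r : S → ℝ≥0, Measurable[ratioSigma F] r ∧ ∃ f ∈ F, h = fun s => r s * f s}

/-- `T` is a regular set isomorphism from the σ-field `m₁` (with measure `μ₁`) to the σ-field
`m₂` (with measure `μ₂`). -/
structure IsRegularSetIso {S₁ S₂ : Type*} [MeasurableSpace S₁] [MeasurableSpace S₂]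
    (μ₁ : Measure S₁) (μ₂ : Measure S₂) (m₁ : MeasurableSpace S₁) (m₂ : MeasurableSpace S₂)
    (T : Set S₁ → Set S₂) : Prop where
  measurable : ∀ A, MeasurableSet[m₁] A → MeasurableSet[m₂] (T A)
  compl : ∀ A, MeasurableSet[m₁] A → (T Aᶜ : Set S₂) =ᵐ[μ₂] (T univ \ T A : Set S₂)
  iUnion : ∀ A : ℕ → Set S₁, (∀ n, MeasurableSet[m₁] (A n)) →
    Pairwise (fun i j => Disjoint (A i) (A j)) →
    (T (⋃ n, A n) : Set S₂) =ᵐ[μ₂] (⋃ n, T (A n) : Set S₂)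
  null_iff : ∀ A, MeasurableSet[m₁] A → (μ₂ (T A) = 0 ↔ μ₁ A = 0)

/-- `T` maps `m₁` onto the trace of `m₂` on `T(S₁)`, modulo `μ₂`. -/
def IsOntoTrace {S₁ S₂ : Type*} [MeasurableSpace S₂] (μ₂ : Measure S₂)
    (m₁ : MeasurableSpace S₁) (m₂ : MeasurableSpace S₂) (T : Set S₁ → Set S₂) : Prop :=
  ∀ B, MeasurableSet[m₂] B →
    ∃ A, MeasurableSet[m₁] A ∧ (T A : Set S₂) =ᵐ[μ₂] (B ∩ T univ : Set S₂)

/-- `q = T r` for the function map induced by the set map `T`: `{q ∈ B} = T {r ∈ B}` modulo `μ₂`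
on `T(S₁)` for every Borel set `B`, and `q = 0` almost everywhere outside `T(S₁)`. -/
structure IsInducedBy {S₁ S₂ : Type*} [MeasurableSpace S₂] (μ₂ : Measure S₂)
    (m₂ : MeasurableSpace S₂) (T : Set S₁ → Set S₂) (r : S₁ → ℝ≥0) (q : S₂ → ℝ≥0) : Prop where
  measurable : Measurable[m₂] q
  preimage : ∀ B : Set ℝ≥0, MeasurableSet B →
    (q ⁻¹' B ∩ T univ : Set S₂) =ᵐ[μ₂] (T (r ⁻¹' B) : Set S₂)
  zero_off : ∀ᵐ t ∂μ₂, t ∉ T univ → q t = 0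

/-!
Fix `f₀ ∈ F`; modifying it on a null set, it may be taken without zeros. Everything rests on the
joint law of the ratios `(f / f₀)`, `f ∈ F`, viewed as one random element of the product space
`F → ℝ≥0` under the finite measure `f₀ ^ α dμ₁`: it equals the joint law of `(U f / U f₀)`, `f ∈ F`,
under `(U f₀) ^ α dμ₂`.

For this, note that the norms of the functions `f ∨ c g` determine the integral of `g ^ α` over
`{f < g}`, as a one-sided derivative in `c ^ α` at `c = 1` (`tendsto_setLIntegral_lt`); so a
max-linear isometry preserves this integral (`IsMaxLinearIsometryOn.setLIntegral_lt`). Applied to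
`n f₀ < g` with `n → ∞`, this shows that `U f₀` has full support in `U(F)`. Applied to
`⋁ᵢ cᵢ⁻¹ fᵢ < f₀`, it gives equal masses to the orthants `{fᵢ / f₀ < cᵢ for all i}` on both sides,
and the orthants form a generating π-system (`IsMaxLinearIsometryOn.map_ratioMap_eq`).

Functions that are `ρ(F)`-measurable are exactly the measurable functions `k` of the ratios to `f₀`,
and on the support of `U f₀` the same holds for `ρ(U(F))` (`exists_eq_comp_ratioMap`). Hence
`k(f / f₀ : f ∈ F) ↦ k(U f / U f₀ : f ∈ F)` is well defined mod `μ₂` and transports functions; its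
action on indicators is the set isomorphism `T`, and `r f₀ ↦ (T r) (U f₀)` is the extension of `U`.
The extended ratio space is itself a max-linear cone, so the equality of joint laws applies to every
isometric extension of `U`, and this forces uniqueness.
-/

section

open Filter Topology

variable {S S₁ S₂ : Type*} [MeasurableSpace S] [MeasurableSpace S₁] [MeasurableSpace S₂]
  {μ : Measure S} {μ₁ : Measure S₁} {μ₂ : Measure S₂} {α : ℝ}

/-! ### The comparison functional of a pair of functions -/

theorem measurable_coe_rpow (α : ℝ) {f : S → ℝ≥0} (hf : Measurable f) :
    Measurable fun s => (f s : ℝ≥0∞) ^ α :=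
  hf.coe_nnreal_ennreal.pow_const α

theorem LPlus.max_mem (hα : 0 < α) {f g : S → ℝ≥0} (hf : f ∈ LPlus α μ) (hg : g ∈ LPlus α μ)
    (a b : ℝ≥0) : (fun s => max (a * f s) (b * g s)) ∈ LPlus α μ := by
  refine ⟨(hf.1.const_mul a).max (hg.1.const_mul b), ?_⟩
  calc ∫⁻ s, ((max (a * f s) (b * g s) : ℝ≥0) : ℝ≥0∞) ^ α ∂μ
      ≤ ∫⁻ s, ((a : ℝ≥0∞) ^ α * (f s : ℝ≥0∞) ^ α + (b : ℝ≥0∞) ^ α * (g s : ℝ≥0∞) ^ α) ∂μ := by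
        refine lintegral_mono fun s => ?_
        rcases max_choice (a * f s) (b * g s) with h | h <;> rw [h, ENNReal.coe_mul,
          ENNReal.mul_rpow_of_nonneg _ _ hα.le]
        exacts [le_self_add, le_add_self]
    _ = (a : ℝ≥0∞) ^ α * ∫⁻ s, (f s : ℝ≥0∞) ^ α ∂μ
        + (b : ℝ≥0∞) ^ α * ∫⁻ s, (g s : ℝ≥0∞) ^ α ∂μ := by
        rw [lintegral_add_left ((measurable_coe_rpow α hf.1).const_mul _),
          lintegral_const_mul _ (measurable_coe_rpow α hf.1),
          lintegral_const_mul _ (measurable_coe_rpow α hg.1)]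
    _ < ∞ := ENNReal.add_lt_top.2
        ⟨ENNReal.mul_lt_top (ENNReal.rpow_lt_top_of_nonneg hα.le ENNReal.coe_ne_top) hf.2,
          ENNReal.mul_lt_top (ENNReal.rpow_lt_top_of_nonneg hα.le ENNReal.coe_ne_top) hg.2⟩

/-- The factors `cₙ ↑ 1` with `cₙ ^ α = (n + 1) / (n + 2)`. -/
noncomputable def scaleSeq (α : ℝ) (n : ℕ) : ℝ≥0 := (((n : ℝ≥0) + 1) / (n + 2)) ^ (1 / α)

theorem scaleSeq_pos (α : ℝ) (n : ℕ) : 0 < scaleSeq α n :=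
  NNReal.rpow_pos (by positivity)

theorem scaleSeq_rpow (hα : 0 < α) (n : ℕ) :
    scaleSeq α n ^ α = ((n : ℝ≥0) + 1) / (n + 2) := by
  rw [scaleSeq, ← NNReal.rpow_mul, one_div_mul_cancel hα.ne', NNReal.rpow_one]

theorem scaleSeq_rpow_add (hα : 0 < α) (n : ℕ) :
    scaleSeq α n ^ α + ((n : ℝ≥0) + 2)⁻¹ = 1 := by
  rw [scaleSeq_rpow hα]
  field_simp
  ring

theorem scaleSeq_le_one (hα : 0 < α) (n : ℕ) : scaleSeq α n ≤ 1 := by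
  refine NNReal.rpow_le_one ?_ (by positivity)
  exact div_le_one_of_le₀ (by gcongr; norm_num) (by positivity)

theorem tendsto_scaleSeq (hα : 0 < α) : Tendsto (scaleSeq α) atTop (𝓝 1) := by
  have h : Tendsto (fun n : ℕ => ((n : ℝ≥0) + 1) / (n + 2)) atTop (𝓝 1) := by
    rw [← NNReal.tendsto_coe]
    push_cast
    have h1 : Tendsto (fun n : ℕ => ((n : ℝ) + 2)⁻¹) atTop (𝓝 0) :=
      (tendsto_natCast_atTop_atTop.atTop_add tendsto_const_nhds).inv_tendsto_atTop
    have h2 := h1.const_sub 1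
    rw [sub_zero] at h2
    refine h2.congr fun n => ?_
    have : (n : ℝ) + 2 ≠ 0 := by positivity
    field_simp
    ring
  have h3 := ((NNReal.continuous_rpow_const (y := 1 / α) (by positivity)).tendsto 1).comp h
  rwa [NNReal.one_rpow] at h3

/-- The integral of `g ^ α` over `{f < g}` is a one-sided derivative at `c = 1` of
`c ^ α ↦ ∫ (f ∨ c g) ^ α dμ`, hence is determined by the norms of the functions `f ∨ c g`. -/
theorem tendsto_setLIntegral_lt (hα : 0 < α) {f g : S → ℝ≥0} (hf : f ∈ LPlus α μ)
    (hg : g ∈ LPlus α μ) :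
    Tendsto (fun n : ℕ => ((n : ℝ≥0) + 2 : ℝ≥0) *
        (∫⁻ s, ((max (1 * f s) (1 * g s) : ℝ≥0) : ℝ≥0∞) ^ α ∂μ
          - ∫⁻ s, ((max (1 * f s) (scaleSeq α n * g s) : ℝ≥0) : ℝ≥0∞) ^ α ∂μ))
      atTop (𝓝 (∫⁻ s in {s | f s < g s}, (g s : ℝ≥0∞) ^ α ∂μ)) := by
  have hms : MeasurableSet {s | f s < g s} := measurableSet_lt hf.1 hg.1
  have hmB : ∀ n, Measurable fun s =>
      ((max (1 * f s) (scaleSeq α n * g s) : ℝ≥0) : ℝ≥0∞) ^ α := fun n =>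
    measurable_coe_rpow α ((hf.1.const_mul _).max (hg.1.const_mul _))
  have hmA : Measurable fun s => ((max (1 * f s) (1 * g s) : ℝ≥0) : ℝ≥0∞) ^ α :=
    measurable_coe_rpow α ((hf.1.const_mul _).max (hg.1.const_mul _))
  have key : ∀ (n : ℕ) (s : S), (((n : ℝ≥0) + 2 : ℝ≥0) : ℝ≥0∞) *
      ((g s : ℝ≥0∞) ^ α * (((n : ℝ≥0) + 2)⁻¹ : ℝ≥0)) = (g s : ℝ≥0∞) ^ α := by
    intro n s
    rw [mul_left_comm, ← ENNReal.coe_mul, mul_inv_cancel₀ (by positivity), ENNReal.coe_one,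
      mul_one]
  have hsplit : ∀ n s, (g s : ℝ≥0∞) ^ α = ((scaleSeq α n * g s : ℝ≥0) : ℝ≥0∞) ^ α +
      (g s : ℝ≥0∞) ^ α * (((n : ℝ≥0) + 2)⁻¹ : ℝ≥0) := by
    intro n s
    rw [ENNReal.coe_mul, ENNReal.mul_rpow_of_nonneg _ _ hα.le,
      ← ENNReal.coe_rpow_of_nonneg (scaleSeq α n) hα.le, mul_comm ((g s : ℝ≥0∞) ^ α), ← add_mul,
      ← ENNReal.coe_add, scaleSeq_rpow_add hα, ENNReal.coe_one, one_mul]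
  have hmono : ∀ {x y : ℝ≥0}, x ≤ y → (x : ℝ≥0∞) ^ α ≤ (y : ℝ≥0∞) ^ α := fun h =>
    ENNReal.rpow_le_rpow (ENNReal.coe_le_coe.2 h) hα.le
  rw [← lintegral_indicator hms]
  have heq : ∀ n : ℕ, ((n : ℝ≥0) + 2 : ℝ≥0) *
        (∫⁻ s, ((max (1 * f s) (1 * g s) : ℝ≥0) : ℝ≥0∞) ^ α ∂μ
          - ∫⁻ s, ((max (1 * f s) (scaleSeq α n * g s) : ℝ≥0) : ℝ≥0∞) ^ α ∂μ) =
      ∫⁻ s, ((n : ℝ≥0) + 2 : ℝ≥0) * (((max (1 * f s) (1 * g s) : ℝ≥0) : ℝ≥0∞) ^ α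
          - ((max (1 * f s) (scaleSeq α n * g s) : ℝ≥0) : ℝ≥0∞) ^ α) ∂μ := by
    intro n
    rw [lintegral_const_mul _ (by exact hmA.sub (hmB n)), lintegral_sub (hmB n)
      (LPlus.max_mem hα hf hg 1 (scaleSeq α n)).2.ne]
    exact Eventually.of_forall fun s => hmono
      (max_le_max le_rfl (mul_le_mul_left (scaleSeq_le_one hα n) _))
  simp_rw [heq]
  refine tendsto_lintegral_of_dominated_convergence (fun s => (g s : ℝ≥0∞) ^ α)
    (fun n => (hmA.sub (hmB n)).const_mul _) (fun n => Eventually.of_forall fun s => ?_) hg.2.ne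
    (Eventually.of_forall fun s => ?_)
  · beta_reduce
    rw [← key n s]
    refine mul_le_mul_right ?_ _
    rw [tsub_le_iff_left, one_mul, one_mul]
    rcases le_total (f s) (g s) with h | h
    · rw [max_eq_right h]
      nth_rewrite 1 [hsplit n s]
      gcongr
      exact le_max_right _ _
    · rw [max_eq_left h]
      exact (hmono (le_max_left _ _)).trans le_self_add
  · by_cases h : f s < g s
    · rw [indicator_of_mem (show s ∈ {s | f s < g s} from h)]
      have hev : ∀ᶠ n in atTop, f s < scaleSeq α n * g s := by
        have := (tendsto_scaleSeq hα).mul_const (g s)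
        rw [one_mul] at this
        exact this.eventually_const_lt h
      refine tendsto_const_nhds.congr' (hev.mono fun n hn => ?_)
      beta_reduce
      rw [one_mul, one_mul, max_eq_right h.le, max_eq_right hn.le]
      rw [ENNReal.sub_eq_of_eq_add_rev (b := ((scaleSeq α n * g s : ℝ≥0) : ℝ≥0∞) ^ α)
        (ENNReal.rpow_lt_top_of_nonneg hα.le ENNReal.coe_ne_top).ne (hsplit n s), key n s]
    · rw [indicator_of_notMem (show s ∉ {s | f s < g s} from h)]
      push Not at h
      refine tendsto_const_nhds.congr fun n => ?_
      rw [one_mul, one_mul, max_eq_left h, max_eq_left, tsub_self, mul_zero]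
      calc scaleSeq α n * g s ≤ 1 * g s := by gcongr; exact scaleSeq_le_one hα n
        _ ≤ f s := by rwa [one_mul]

/-! ### Isometries of max-linear cones -/

/-- Stability under the max-linear combinations `a f ∨ b g` with positive coefficients. -/
def IsMaxCone {X : Type*} (D : Set (X → ℝ≥0)) : Prop :=
  ∀ f ∈ D, ∀ g ∈ D, ∀ a b : ℝ≥0, 0 < a → 0 < b → (fun s => max (a * f s) (b * g s)) ∈ D

theorem IsMaxCone.smul_mem {X : Type*} {D : Set (X → ℝ≥0)} (hD : IsMaxCone D)
    {f : X → ℝ≥0} (hf : f ∈ D) {a : ℝ≥0} (ha : 0 < a) : (fun s => a * f s) ∈ D := by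
  simpa using hD f hf f hf a a ha ha

variable {D : Set (S₁ → ℝ≥0)} {V : (S₁ → ℝ≥0) → (S₂ → ℝ≥0)}

theorem IsMaxLinearIsometryOn.map_smul (hV : IsMaxLinearIsometryOn α μ₁ μ₂ D V)
    {f : S₁ → ℝ≥0} (hf : f ∈ D) (a : ℝ≥0) :
    V (fun s => a * f s) =ᵐ[μ₂] fun t => a * V f t := by
  simpa using hV.map_max f hf f hf a a

theorem IsMaxLinearIsometryOn.lintegral_eq (hα : 0 < α)
    (hV : IsMaxLinearIsometryOn α μ₁ μ₂ D V) {f : S₁ → ℝ≥0} (hf : f ∈ D) :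
    ∫⁻ t, (V f t : ℝ≥0∞) ^ α ∂μ₂ = ∫⁻ s, (f s : ℝ≥0∞) ^ α ∂μ₁ :=
  ENNReal.rpow_left_injective (one_div_pos.2 hα).ne' (hV.norm_eq f hf)

theorem IsMaxLinearIsometryOn.setLIntegral_lt (hα : 0 < α) (hD : IsMaxCone D)
    (hsub : D ⊆ LPlus α μ₁) (hV : IsMaxLinearIsometryOn α μ₁ μ₂ D V) {f g : S₁ → ℝ≥0}
    (hf : f ∈ D) (hg : g ∈ D) :
    ∫⁻ t in {t | V f t < V g t}, (V g t : ℝ≥0∞) ^ α ∂μ₂ =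
      ∫⁻ s in {s | f s < g s}, (g s : ℝ≥0∞) ^ α ∂μ₁ := by
  have hmax : ∀ c : ℝ≥0, 0 < c →
      ∫⁻ t, ((max (1 * V f t) (c * V g t) : ℝ≥0) : ℝ≥0∞) ^ α ∂μ₂ =
      ∫⁻ s, ((max (1 * f s) (c * g s) : ℝ≥0) : ℝ≥0∞) ^ α ∂μ₁ := by
    intro c hc
    rw [← hV.lintegral_eq hα (hD f hf g hg 1 c one_pos hc)]
    refine lintegral_congr_ae ?_
    filter_upwards [hV.map_max f hf g hg 1 c] with t ht
    rw [ht]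
  have h1 := tendsto_setLIntegral_lt hα (hV.mapsTo f hf) (hV.mapsTo g hg)
  simp_rw [hmax 1 one_pos, hmax _ (scaleSeq_pos α _)] at h1
  exact tendsto_nhds_unique h1 (tendsto_setLIntegral_lt hα (hsub hf) (hsub hg))

/-- The image of a function without zeros has full support: the mass of `V g` on
`{n V f₀ < V g}` equals the mass of `g` on `{n f₀ < g}`, and these sets decrease to `∅`. -/
theorem IsMaxLinearIsometryOn.ae_eq_zero_of_eq_zero (hα : 0 < α) (hD : IsMaxCone D)
    (hsub : D ⊆ LPlus α μ₁) (hV : IsMaxLinearIsometryOn α μ₁ μ₂ D V) {f₀ g : S₁ → ℝ≥0}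
    (hf₀ : f₀ ∈ D) (hpos : ∀ s, 0 < f₀ s) (hg : g ∈ D) :
    ∀ᵐ t ∂μ₂, V f₀ t = 0 → V g t = 0 := by
  set ν := μ₁.withDensity fun s => (g s : ℝ≥0∞) ^ α with hν
  set A : ℕ → Set S₁ := fun n => {s | ((n : ℝ≥0) + 1) * f₀ s < g s} with hA
  have hAm : ∀ n, MeasurableSet (A n) := fun n =>
    measurableSet_lt ((hsub hf₀).1.const_mul _) (hsub hg).1
  have hfin : ν univ < ∞ := by
    rw [hν, withDensity_apply _ MeasurableSet.univ, setLIntegral_univ]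
    exact (hsub hg).2
  have hanti : Antitone A := by
    intro m n hmn s hs
    refine lt_of_le_of_lt ?_ (show _ < g s from hs)
    gcongr
  have hempty : ⋂ n, A n = ∅ := by
    refine eq_empty_of_forall_notMem fun s hs => ?_
    obtain ⟨n, hn⟩ := exists_nat_gt (g s / f₀ s)
    have h1 := mem_iInter.1 hs n
    rw [div_lt_iff₀ (hpos s)] at hn
    have h2 : (n : ℝ≥0) * f₀ s ≤ (n + 1) * f₀ s := by gcongr; exact le_self_add
    exact lt_irrefl _ ((hn.trans_le h2).trans h1)
  have hlim : Tendsto (ν ∘ A) atTop (𝓝 0) := by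
    have := tendsto_measure_iInter_atTop (μ := ν) (fun n => (hAm n).nullMeasurableSet) hanti
      ⟨0, ((measure_mono (subset_univ _)).trans_lt hfin).ne⟩
    rwa [hempty, measure_empty] at this
  have hVm := (hV.mapsTo f₀ hf₀).1
  have hVgm := (hV.mapsTo g hg).1
  have hle : ∀ n, ∫⁻ t in {t | V f₀ t = 0}, (V g t : ℝ≥0∞) ^ α ∂μ₂ ≤ (ν ∘ A) n := by
    intro n
    have hn : (0 : ℝ≥0) < n + 1 := by positivity
    have h1 := hV.setLIntegral_lt hα hD hsub (hD.smul_mem hf₀ hn) hg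
    simp only [Function.comp_apply]
    rw [hν, withDensity_apply _ (hAm n), hA, ← h1,
      ← lintegral_indicator (measurableSet_eq_fun hVm measurable_const),
      ← lintegral_indicator (measurableSet_lt (hV.mapsTo _ (hD.smul_mem hf₀ hn)).1 hVgm)]
    refine lintegral_mono_ae ?_
    filter_upwards [hV.map_smul hf₀ (n + 1)] with t ht
    by_cases h0 : V f₀ t = 0
    · rcases eq_zero_or_pos (V g t) with hg0 | hg0
      · rw [indicator_of_mem (show t ∈ {t | V f₀ t = 0} from h0), hg0, ENNReal.coe_zero,
          ENNReal.zero_rpow_of_pos hα]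
        exact zero_le
      · rw [indicator_of_mem (show t ∈ {t | V f₀ t = 0} from h0), indicator_of_mem]
        rw [mem_ofPred_eq, ht, h0, mul_zero]
        exact hg0
    · rw [indicator_of_notMem (show t ∉ {t | V f₀ t = 0} from h0)]
      exact zero_le
  have hzero := le_antisymm (ge_of_tendsto' hlim hle) zero_le
  rw [setLIntegral_eq_zero_iff (measurableSet_eq_fun hVm measurable_const)
    (measurable_coe_rpow α hVgm)] at hzero
  filter_upwards [hzero] with t ht h0
  simpa [hα, hα.not_gt] using ht h0

/-! ### The joint law of the ratios -/

/-- All ratios of a family `G` to a fixed function `g`, as one map into a product space. -/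
noncomputable def ratioMap {ι X : Type*} (G : ι → X → ℝ≥0) (g : X → ℝ≥0) : X → ι → ℝ≥0 :=
  fun x i => G i x / g x

theorem measurable_ratioMap {ι : Type*} {G : ι → S → ℝ≥0} {g : S → ℝ≥0}
    (hG : ∀ i, Measurable (G i)) (hg : Measurable g) : Measurable (ratioMap G g) :=
  measurable_pi_lambda _ fun i => (hG i).div hg

/-- The finite-dimensional open lower orthants with positive corners. -/
def orthants (ι : Type*) : Set (Set (ι → ℝ≥0)) :=
  {C | ∃ s : Finset (ι × ℝ≥0), (∀ p ∈ s, 0 < p.2) ∧ C = {x | ∀ p ∈ s, x p.1 < p.2}}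

theorem isPiSystem_orthants (ι : Type*) : IsPiSystem (orthants ι) := by
  classical
  rintro _ ⟨s, hs, rfl⟩ _ ⟨s', hs', rfl⟩ -
  refine ⟨s ∪ s', fun p hp => (Finset.mem_union.1 hp).elim (hs p) (hs' p), ?_⟩
  ext x
  simp only [mem_inter_iff, mem_ofPred_eq, Finset.mem_union, or_imp, forall_and]

theorem measurableSet_orthant {ι : Type*} (s : Finset (ι × ℝ≥0)) :
    MeasurableSet {x : ι → ℝ≥0 | ∀ p ∈ s, x p.1 < p.2} := by
  have : {x : ι → ℝ≥0 | ∀ p ∈ s, x p.1 < p.2} = ⋂ p ∈ s, {x | x p.1 < p.2} := by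
    ext x
    simp
  rw [this]
  exact s.measurableSet_biInter fun p _ =>
    measurableSet_lt (measurable_pi_apply p.1) measurable_const

theorem generateFrom_orthants (ι : Type*) :
    (MeasurableSpace.pi : MeasurableSpace (ι → ℝ≥0)) =
      MeasurableSpace.generateFrom (orthants ι) := by
  refine le_antisymm (iSup_le fun i => ?_) (MeasurableSpace.generateFrom_le ?_)
  · rw [BorelSpace.measurable_eq (α := ℝ≥0), borel_eq_generateFrom_Iio,
      MeasurableSpace.comap_generateFrom]
    refine MeasurableSpace.generateFrom_le ?_
    rintro _ ⟨_, ⟨c, rfl⟩, rfl⟩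
    rcases eq_zero_or_pos c with rfl | hc
    · have : (fun x : ι → ℝ≥0 => x i) ⁻¹' Iio 0 = ∅ := by
        ext x
        simp
      rw [this]
      exact @MeasurableSet.empty _ (_)
    · refine MeasurableSpace.measurableSet_generateFrom ⟨{(i, c)}, ?_, ?_⟩
      · simpa using hc
      · ext x
        simp
  · rintro _ ⟨s, -, rfl⟩
    exact measurableSet_orthant s

/-- An orthant of ratios has the form `{g < f₀}` with `g ∈ D`, both for `D` and for its image:
this is where max-linearity enters. -/
theorem IsMaxLinearIsometryOn.exists_orthant (hD : IsMaxCone D)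
    (hV : IsMaxLinearIsometryOn α μ₁ μ₂ D V) {f₀ : S₁ → ℝ≥0} (hf₀ : f₀ ∈ D)
    (hpos : ∀ s, 0 < f₀ s) (u : Finset (D × ℝ≥0)) (hu : ∀ p ∈ u, 0 < p.2) :
    ∃ g ∈ D, (∀ x, g x < f₀ x ↔ ∀ p ∈ u, ratioMap (fun f : D => f.1) f₀ x p.1 < p.2) ∧
      ∀ᵐ t ∂μ₂, V f₀ t ≠ 0 →
        (V g t < V f₀ t ↔ ∀ p ∈ u, ratioMap (fun f : D => V f.1) (V f₀) t p.1 < p.2) := by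
  classical
  induction u using Finset.induction_on with
  | empty =>
    refine ⟨_, hD.smul_mem hf₀ (a := 2⁻¹) (by positivity), fun x => ?_, ?_⟩
    · have h := NNReal.half_lt_self (hpos x).ne'
      rw [div_eq_mul_inv, mul_comm] at h
      exact iff_of_true h (by simp)
    · filter_upwards [hV.map_smul hf₀ 2⁻¹] with t ht h0
      rw [ht]
      simpa [mul_comm, div_eq_mul_inv] using NNReal.half_lt_self h0
  | insert p u hp ih =>
    obtain ⟨g, hg, h1, h2⟩ := ih fun q hq => hu q (Finset.mem_insert_of_mem hq)
    have hp0 : 0 < p.2 := hu p (Finset.mem_insert_self _ _)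
    -- `f < c f₀` is equivalent to `c⁻¹ f < f₀`
    have key : ∀ x y : ℝ≥0, 0 < y → (p.2⁻¹ * x < y ↔ x / y < p.2) := by
      intro x y hy
      rw [div_lt_iff₀ hy, inv_mul_lt_iff₀ hp0]
    refine ⟨_, hD g hg p.1.1 p.1.2 1 p.2⁻¹ one_pos (inv_pos.2 hp0), fun x => ?_, ?_⟩
    · rw [max_lt_iff, one_mul, h1, key _ _ (hpos x), Finset.forall_mem_insert, and_comm]
      rfl
    · filter_upwards [h2, hV.map_max g hg p.1.1 p.1.2 1 p.2⁻¹] with t h2 ht h0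
      rw [ht, max_lt_iff, one_mul, h2 h0, key _ _ (pos_iff_ne_zero.2 h0),
        Finset.forall_mem_insert, and_comm]
      rfl

/-- A max-linear isometry preserves the joint law of all ratios to `f₀`, where `f₀ ^ α dμ₁` and
`(V f₀) ^ α dμ₂` serve as reference measures. -/
theorem IsMaxLinearIsometryOn.map_ratioMap_eq (hα : 0 < α) (hD : IsMaxCone D)
    (hsub : D ⊆ LPlus α μ₁) (hV : IsMaxLinearIsometryOn α μ₁ μ₂ D V) {f₀ : S₁ → ℝ≥0}
    (hf₀ : f₀ ∈ D) (hpos : ∀ s, 0 < f₀ s) :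
    (μ₂.withDensity fun t => (V f₀ t : ℝ≥0∞) ^ α).map (ratioMap (fun f : D => V f.1) (V f₀)) =
      (μ₁.withDensity fun s => (f₀ s : ℝ≥0∞) ^ α).map (ratioMap (fun f : D => f.1) f₀) := by
  have hm₁ : Measurable (ratioMap (fun f : D => f.1) f₀) :=
    measurable_ratioMap (fun f => (hsub f.2).1) (hsub hf₀).1
  have hm₂ : Measurable (ratioMap (fun f : D => V f.1) (V f₀)) :=
    measurable_ratioMap (fun f => (hV.mapsTo _ f.2).1) (hV.mapsTo _ hf₀).1
  have hC : ∀ C ∈ orthants D,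
      (μ₂.withDensity fun t => (V f₀ t : ℝ≥0∞) ^ α).map
        (ratioMap (fun f : D => V f.1) (V f₀)) C =
      (μ₁.withDensity fun s => (f₀ s : ℝ≥0∞) ^ α).map (ratioMap (fun f : D => f.1) f₀) C := by
    rintro _ ⟨u, hu, rfl⟩
    obtain ⟨g, hg, h1, h2⟩ := hV.exists_orthant hD hf₀ hpos u hu
    have hu' := measurableSet_orthant u
    rw [Measure.map_apply hm₁ hu', Measure.map_apply hm₂ hu', withDensity_apply _ (hm₁ hu'),
      withDensity_apply _ (hm₂ hu')]
    have h := hV.setLIntegral_lt hα hD hsub hg hf₀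
    have e1 : {x | g x < f₀ x} = ratioMap (fun f : D => f.1) f₀ ⁻¹'
        {x | ∀ p ∈ u, x p.1 < p.2} := by
      ext x
      exact h1 x
    rw [e1] at h
    rw [← h, ← lintegral_indicator (hm₂ hu'), ← lintegral_indicator
      (measurableSet_lt (hV.mapsTo g hg).1 (hV.mapsTo _ hf₀).1)]
    refine lintegral_congr_ae ?_
    filter_upwards [h2] with t ht
    by_cases h0 : V f₀ t = 0
    · simp [h0, hα]
    · by_cases h1 : V g t < V f₀ t
      · rw [indicator_of_mem (show t ∈ {t | V g t < V f₀ t} from h1), indicator_of_mem]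
        exact (ht h0).1 h1
      · rw [indicator_of_notMem (show t ∉ {t | V g t < V f₀ t} from h1), indicator_of_notMem]
        exact fun h2 => h1 ((ht h0).2 h2)
  have huniv : (univ : Set (D → ℝ≥0)) ∈ orthants D := ⟨∅, by simp, by simp⟩
  have : IsFiniteMeasure (μ₂.withDensity fun t => (V f₀ t : ℝ≥0∞) ^ α) :=
    isFiniteMeasure_withDensity (hV.mapsTo _ hf₀).2.ne
  exact ext_of_generate_finite _ (generateFrom_orthants D) (isPiSystem_orthants D) hC
    (hC _ huniv)

theorem IsMaxLinearIsometryOn.lintegral_ratioMap (hα : 0 < α) (hD : IsMaxCone D)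
    (hsub : D ⊆ LPlus α μ₁) (hV : IsMaxLinearIsometryOn α μ₁ μ₂ D V) {f₀ : S₁ → ℝ≥0}
    (hf₀ : f₀ ∈ D) (hpos : ∀ s, 0 < f₀ s) {φ : (D → ℝ≥0) → ℝ≥0∞} (hφ : Measurable φ) :
    ∫⁻ t, (V f₀ t : ℝ≥0∞) ^ α * φ (ratioMap (fun f : D => V f.1) (V f₀) t) ∂μ₂ =
      ∫⁻ s, (f₀ s : ℝ≥0∞) ^ α * φ (ratioMap (fun f : D => f.1) f₀ s) ∂μ₁ := by
  have hm₁ : Measurable (ratioMap (fun f : D => f.1) f₀) :=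
    measurable_ratioMap (fun f => (hsub f.2).1) (hsub hf₀).1
  have hm₂ : Measurable (ratioMap (fun f : D => V f.1) (V f₀)) :=
    measurable_ratioMap (fun f => (hV.mapsTo _ f.2).1) (hV.mapsTo _ hf₀).1
  have h := congrArg (fun ν => ∫⁻ x, φ x ∂ν) (hV.map_ratioMap_eq hα hD hsub hf₀ hpos)
  simp only [lintegral_map hφ hm₁, lintegral_map hφ hm₂] at h
  exact (lintegral_withDensity_eq_lintegral_mul _
      (measurable_coe_rpow α (hV.mapsTo _ hf₀).1) (hφ.comp hm₂)).symm.trans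
    (h.trans (lintegral_withDensity_eq_lintegral_mul _ (measurable_coe_rpow α (hsub hf₀).1)
      (hφ.comp hm₁)))

theorem IsMaxLinearIsometryOn.ae_ratioMap_iff (hα : 0 < α) (hD : IsMaxCone D)
    (hsub : D ⊆ LPlus α μ₁) (hV : IsMaxLinearIsometryOn α μ₁ μ₂ D V) {f₀ : S₁ → ℝ≥0}
    (hf₀ : f₀ ∈ D) (hpos : ∀ s, 0 < f₀ s) {C : Set (D → ℝ≥0)} (hC : MeasurableSet C) :
    (∀ᵐ t ∂μ₂, V f₀ t ≠ 0 → ratioMap (fun f : D => V f.1) (V f₀) t ∈ C) ↔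
      ∀ᵐ s ∂μ₁, ratioMap (fun f : D => f.1) f₀ s ∈ C := by
  have hm₁ : Measurable (ratioMap (fun f : D => f.1) f₀) :=
    measurable_ratioMap (fun f => (hsub f.2).1) (hsub hf₀).1
  have hm₂ : Measurable (ratioMap (fun f : D => V f.1) (V f₀)) :=
    measurable_ratioMap (fun f => (hV.mapsTo _ f.2).1) (hV.mapsTo _ hf₀).1
  have h := ae_map_iff (p := (· ∈ C)) hm₂.aemeasurable hC
    (μ := μ₂.withDensity fun t => (V f₀ t : ℝ≥0∞) ^ α)
  rw [hV.map_ratioMap_eq hα hD hsub hf₀ hpos, ae_map_iff (p := (· ∈ C)) hm₁.aemeasurable hC,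
    ae_withDensity_iff (measurable_coe_rpow α (hsub hf₀).1),
    ae_withDensity_iff (measurable_coe_rpow α (hV.mapsTo _ hf₀).1)] at h
  symm
  simpa [hα, hα.not_gt, (hpos _).ne'] using h

/-! ### The ratio σ-field and factorization through the ratios -/

theorem measurable_indicator_one {X : Type*} {m : MeasurableSpace X} {A : Set X}
    (hA : MeasurableSet A) : Measurable (A.indicator (1 : X → ℝ≥0)) :=
  measurable_one.indicator hA

theorem measurable_div_ratioSigma {X : Type*} {F : Set (X → ℝ≥0)} {f g : X → ℝ≥0} (hf : f ∈ F)
    (hg : g ∈ F) :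
    Measurable[ratioSigma F] fun x => (f x : ℝ≥0∞) / (g x : ℝ≥0∞) := by
  have h : MeasurableSpace.comap (fun x => (f x : ℝ≥0∞) / (g x : ℝ≥0∞)) (borel ℝ≥0∞) ≤
      ratioSigma F :=
    le_iSup₂_of_le f hf (le_iSup₂_of_le g hg le_rfl)
  rw [BorelSpace.measurable_eq (α := ℝ≥0∞)]
  exact measurable_iff_comap_le.2 h

theorem measurable_nndiv_ratioSigma {X : Type*} {F : Set (X → ℝ≥0)} {f g : X → ℝ≥0}
    (hf : f ∈ F) (hg : g ∈ F) : Measurable[ratioSigma F] fun x => f x / g x := by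
  -- where `g` vanishes, `f / g ∈ {0, ∞}` and both values are sent to `0`
  have : (fun x => f x / g x) = fun x => ((f x : ℝ≥0∞) / (g x : ℝ≥0∞)).toNNReal := by
    ext x
    simp [ENNReal.toNNReal_div]
  rw [this]
  exact (measurable_div_ratioSigma hf hg).ennreal_toNNReal

theorem measurableSet_support_ratioSigma {X : Type*} {F : Set (X → ℝ≥0)} {g : X → ℝ≥0}
    (hg : g ∈ F) : MeasurableSet[ratioSigma F] {x | g x ≠ 0} := by
  have : {x | g x ≠ 0} = (fun x => g x / g x) ⁻¹' {1} := by
    ext x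
    by_cases h : g x = 0 <;> simp [h]
  rw [this]
  exact measurable_nndiv_ratioSigma hg hg (measurableSet_singleton 1)

theorem ratioSigma_le {F : Set (S → ℝ≥0)} (hF : ∀ f ∈ F, Measurable f) :
    ratioSigma F ≤ ‹MeasurableSpace S› := by
  refine iSup₂_le fun f hf => iSup₂_le fun g hg => ?_
  rw [← BorelSpace.measurable_eq (α := ℝ≥0∞)]
  exact ((hF f hf).coe_nnreal_ennreal.div (hF g hg).coe_nnreal_ennreal).comap_le

theorem measurable_ratioMap_ratioSigma {ι X : Type*} {F : Set (X → ℝ≥0)} {G : ι → X → ℝ≥0}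
    (hG : ∀ i, G i ∈ F) {g : X → ℝ≥0} (hg : g ∈ F) :
    Measurable[ratioSigma F] (ratioMap G g) := by
  let _ : MeasurableSpace X := ratioSigma F
  exact measurable_pi_lambda _ fun i => measurable_nndiv_ratioSigma (hG i) hg

/-- On `{g ≠ 0}`, a `ρ(F)`-measurable function is a measurable function of the ratios to `g`,
because `f₁ / f₂ = (f₁ / g) / (f₂ / g)` there. -/
theorem exists_eq_comp_ratioMap {ι X : Type*} {F : Set (X → ℝ≥0)} {G : ι → X → ℝ≥0}
    (hG : ∀ f ∈ F, ∃ i, G i = f) (g : X → ℝ≥0) {q : X → ℝ≥0} (hq : Measurable[ratioSigma F] q) :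
    ∃ k : (ι → ℝ≥0) → ℝ≥0, Measurable k ∧ ∀ x, g x ≠ 0 → q x = k (ratioMap G g x) := by
  set φ : {x // g x ≠ 0} → ι → ℝ≥0 := fun x => ratioMap G g x.1 with hφ
  have hle : MeasurableSpace.comap (Subtype.val : {x // g x ≠ 0} → X) (ratioSigma F) ≤
      MeasurableSpace.comap φ MeasurableSpace.pi := by
    rw [MeasurableSpace.comap_le_iff_le_map]
    refine iSup₂_le fun f₁ hf₁ => iSup₂_le fun f₂ hf₂ => ?_
    obtain ⟨i, rfl⟩ := hG f₁ hf₁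
    obtain ⟨j, rfl⟩ := hG f₂ hf₂
    rw [← BorelSpace.measurable_eq (α := ℝ≥0∞), ← MeasurableSpace.comap_le_iff_le_map,
      MeasurableSpace.comap_comp, ← measurable_iff_comap_le]
    have hcomp : (fun x => (G i x : ℝ≥0∞) / (G j x : ℝ≥0∞)) ∘
        (Subtype.val : {x // g x ≠ 0} → X) =
        (fun y : ι → ℝ≥0 => (y i : ℝ≥0∞) / (y j : ℝ≥0∞)) ∘ φ := by
      ext x
      have h0 : (g x.1 : ℝ≥0∞) ≠ 0 := ENNReal.coe_ne_zero.2 x.2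
      simp only [Function.comp_apply, hφ, ratioMap]
      rw [ENNReal.coe_div x.2, ENNReal.coe_div x.2, div_eq_mul_inv _ (g x.1 : ℝ≥0∞),
        div_eq_mul_inv _ (g x.1 : ℝ≥0∞), ENNReal.mul_div_mul_right _ _
          (ENNReal.inv_ne_zero.2 ENNReal.coe_ne_top) (ENNReal.inv_ne_top.2 h0)]
    rw [hcomp]
    exact (((measurable_pi_apply i).coe_nnreal_ennreal).div
      ((measurable_pi_apply j).coe_nnreal_ennreal)).comp (comap_measurable φ)
  have hq' : Measurable[MeasurableSpace.comap φ MeasurableSpace.pi]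
      (fun x : {x // g x ≠ 0} => q x.1) :=
    (hq.comp (comap_measurable Subtype.val)).mono hle le_rfl
  obtain ⟨k, hk, hqk⟩ := hq'.exists_eq_measurable_comp
  exact ⟨k, hk, fun x hx => congrFun hqk ⟨x, hx⟩⟩

/-! ### The maps induced by an isometry -/

/-- A max-linear isometry `V` on a max-linear cone `D` in `L^α_+`, together with a function
`f₀ ∈ D` without zeros, to which ratios are taken. -/
structure IsPointedIsometry (α : ℝ) (μ₁ : Measure S₁) (μ₂ : Measure S₂) (D : Set (S₁ → ℝ≥0))
    (V : (S₁ → ℝ≥0) → (S₂ → ℝ≥0)) (f₀ : S₁ → ℝ≥0) : Prop where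
  exponent_pos : 0 < α
  cone : IsMaxCone D
  subset : D ⊆ LPlus α μ₁
  isometry : IsMaxLinearIsometryOn α μ₁ μ₂ D V
  mem : f₀ ∈ D
  pos : ∀ s, 0 < f₀ s

open Classical in
/-- The transport of functions along the isometry: a function `k` of the ratios `f / f₀` goes to
the same function `k` of the ratios `V f / V f₀`, cut off outside the support of `V f₀`. Functions
that do not factor through the ratios go to `0`. -/
noncomputable def inducedFun {X Y : Type*} (D : Set (X → ℝ≥0)) (V : (X → ℝ≥0) → (Y → ℝ≥0))
    (f₀ : X → ℝ≥0) (r : X → ℝ≥0) : Y → ℝ≥0 :=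
  if h : ∃ k : (D → ℝ≥0) → ℝ≥0, Measurable k ∧
      ∀ x, r x = k (ratioMap (fun f : D => f.1) f₀ x) then
    {t | V f₀ t ≠ 0}.indicator fun t => h.choose (ratioMap (fun f : D => V f.1) (V f₀) t)
  else 0

/-- The transport of sets along the isometry, obtained from the transport of indicators. -/
noncomputable def inducedSet {X Y : Type*} (D : Set (X → ℝ≥0)) (V : (X → ℝ≥0) → (Y → ℝ≥0))
    (f₀ : X → ℝ≥0) (A : Set X) : Set Y :=
  Function.support (inducedFun D V f₀ (A.indicator 1))

/-- The extension `r f₀ ↦ (T r) (V f₀)` of the isometry, where `T` is the transport of functions. -/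
noncomputable def inducedMap {X Y : Type*} (D : Set (X → ℝ≥0)) (V : (X → ℝ≥0) → (Y → ℝ≥0))
    (f₀ : X → ℝ≥0) (h : X → ℝ≥0) : Y → ℝ≥0 :=
  fun t => inducedFun D V f₀ (fun x => h x / f₀ x) t * V f₀ t

theorem inducedFun_eq_zero {X Y : Type*} {D : Set (X → ℝ≥0)} {V : (X → ℝ≥0) → (Y → ℝ≥0)}
    {f₀ r : X → ℝ≥0} {t : Y} (ht : V f₀ t = 0) : inducedFun D V f₀ r t = 0 := by
  unfold inducedFun
  split_ifs with h
  · exact indicator_of_notMem (show t ∉ {t | V f₀ t ≠ 0} from not_not.2 ht) _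
  · rfl

theorem measurable_inducedFun {X Y : Type*} {D : Set (X → ℝ≥0)} {V : (X → ℝ≥0) → (Y → ℝ≥0)}
    {f₀ : X → ℝ≥0} (hf₀ : f₀ ∈ D) (r : X → ℝ≥0) :
    Measurable[ratioSigma (V '' D)] (inducedFun D V f₀ r) := by
  unfold inducedFun
  let _ : MeasurableSpace Y := ratioSigma (V '' D)
  split_ifs with h
  · exact (h.choose_spec.1.comp (measurable_ratioMap_ratioSigma
      (fun f : D => mem_image_of_mem V f.2) (mem_image_of_mem V hf₀))).indicator
      (measurableSet_support_ratioSigma (mem_image_of_mem V hf₀))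
  · exact measurable_const

namespace IsPointedIsometry

variable {f₀ : S₁ → ℝ≥0}

theorem exists_eq_comp (H : IsPointedIsometry α μ₁ μ₂ D V f₀) {r : S₁ → ℝ≥0}
    (hr : Measurable[ratioSigma D] r) :
    ∃ k : (D → ℝ≥0) → ℝ≥0, Measurable k ∧
      ∀ x, r x = k (ratioMap (fun f : D => f.1) f₀ x) := by
  obtain ⟨k, hk, h⟩ := exists_eq_comp_ratioMap (G := fun f : D => f.1)
    (fun f hf => ⟨⟨f, hf⟩, rfl⟩) f₀ hr
  exact ⟨k, hk, fun x => h x (H.pos x).ne'⟩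

theorem exists_eq_preimage (H : IsPointedIsometry α μ₁ μ₂ D V f₀) {A : Set S₁}
    (hA : MeasurableSet[ratioSigma D] A) :
    ∃ C : Set (D → ℝ≥0), MeasurableSet C ∧
      ∀ x, x ∈ A ↔ ratioMap (fun f : D => f.1) f₀ x ∈ C := by
  obtain ⟨k, hk, h⟩ := H.exists_eq_comp (r := A.indicator 1)
    (measurable_indicator_one hA)
  refine ⟨k ⁻¹' {1}, hk (measurableSet_singleton 1), fun x => ?_⟩
  rw [mem_preimage, ← h, mem_singleton_iff]
  by_cases hx : x ∈ A <;> simp [hx]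

/-- The transport does not depend, mod `μ₂`, on the choice of the factorization: the joint laws of
the ratios on both sides agree. -/
theorem inducedFun_ae_eq (H : IsPointedIsometry α μ₁ μ₂ D V f₀) {r : S₁ → ℝ≥0}
    {k : (D → ℝ≥0) → ℝ≥0} (hk : Measurable k)
    (hr : ∀ x, r x = k (ratioMap (fun f : D => f.1) f₀ x)) :
    ∀ᵐ t ∂μ₂, V f₀ t ≠ 0 →
      inducedFun D V f₀ r t = k (ratioMap (fun f : D => V f.1) (V f₀) t) := by
  have h : ∃ k : (D → ℝ≥0) → ℝ≥0, Measurable k ∧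
      ∀ x, r x = k (ratioMap (fun f : D => f.1) f₀ x) := ⟨k, hk, hr⟩
  have h2 := (H.isometry.ae_ratioMap_iff H.exponent_pos H.cone H.subset H.mem H.pos
    (measurableSet_eq_fun h.choose_spec.1 hk)).2
    (Eventually.of_forall fun x => (h.choose_spec.2 x).symm.trans (hr x))
  filter_upwards [h2] with t ht h0
  rw [inducedFun, dif_pos h, indicator_of_mem (show t ∈ {t | V f₀ t ≠ 0} from h0)]
  exact ht h0

theorem inducedSet_ae (H : IsPointedIsometry α μ₁ μ₂ D V f₀) {A : Set S₁}
    {C : Set (D → ℝ≥0)} (hC : MeasurableSet C)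
    (hA : ∀ x, x ∈ A ↔ ratioMap (fun f : D => f.1) f₀ x ∈ C) :
    ∀ᵐ t ∂μ₂, t ∈ inducedSet D V f₀ A ↔
      V f₀ t ≠ 0 ∧ ratioMap (fun f : D => V f.1) (V f₀) t ∈ C := by
  have h := H.inducedFun_ae_eq (r := A.indicator 1) (k := C.indicator 1)
    (measurable_indicator_one hC) fun x => by
      by_cases hx : x ∈ A
      · simp [hx, (hA x).1 hx]
      · simp [hx, (hA x).not.1 hx]
  filter_upwards [h] with t ht
  rw [inducedSet, Function.mem_support]
  by_cases h0 : V f₀ t = 0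
  · simp [inducedFun_eq_zero h0, h0]
  · rw [ht h0]
    simp [h0]

theorem inducedSet_univ_ae (H : IsPointedIsometry α μ₁ μ₂ D V f₀) :
    ∀ᵐ t ∂μ₂, t ∈ inducedSet D V f₀ univ ↔ V f₀ t ≠ 0 := by
  filter_upwards [H.inducedSet_ae (A := univ) MeasurableSet.univ (by simp)] with t ht
  simpa using ht

theorem inducedMap_ae_eq (H : IsPointedIsometry α μ₁ μ₂ D V f₀) {h : S₁ → ℝ≥0}
    {k : (D → ℝ≥0) → ℝ≥0} (hk : Measurable k)
    (hh : ∀ x, h x = k (ratioMap (fun f : D => f.1) f₀ x) * f₀ x) :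
    inducedMap D V f₀ h =ᵐ[μ₂]
      fun t => k (ratioMap (fun f : D => V f.1) (V f₀) t) * V f₀ t := by
  filter_upwards [H.inducedFun_ae_eq hk (r := fun x => h x / f₀ x)
    fun x => by rw [hh, mul_div_cancel_right₀ _ (H.pos x).ne']] with t ht
  by_cases h0 : V f₀ t = 0
  · simp [inducedMap, h0]
  · rw [inducedMap, ht h0]

theorem ae_eq_zero (H : IsPointedIsometry α μ₁ μ₂ D V f₀) {f : S₁ → ℝ≥0} (hf : f ∈ D) :
    ∀ᵐ t ∂μ₂, V f₀ t = 0 → V f t = 0 :=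
  H.isometry.ae_eq_zero_of_eq_zero H.exponent_pos H.cone H.subset H.mem H.pos hf

theorem lintegral_comp_mul (H : IsPointedIsometry α μ₁ μ₂ D V f₀) {k : (D → ℝ≥0) → ℝ≥0}
    (hk : Measurable k) :
    ∫⁻ t, ((k (ratioMap (fun f : D => V f.1) (V f₀) t) * V f₀ t : ℝ≥0) : ℝ≥0∞) ^ α ∂μ₂ =
      ∫⁻ s, ((k (ratioMap (fun f : D => f.1) f₀ s) * f₀ s : ℝ≥0) : ℝ≥0∞) ^ α ∂μ₁ := by
  have h := H.isometry.lintegral_ratioMap H.exponent_pos H.cone H.subset H.mem H.pos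
    (measurable_coe_rpow α hk)
  simpa only [ENNReal.coe_mul, ENNReal.mul_rpow_of_nonneg _ _ H.exponent_pos.le,
    mul_comm] using h

/-! ### The extended ratio space -/

theorem measurable_div_of_mem_extRatioSpace (H : IsPointedIsometry α μ₁ μ₂ D V f₀)
    {h : S₁ → ℝ≥0} (hh : h ∈ extRatioSpace α μ₁ D) :
    Measurable[ratioSigma D] fun x => h x / f₀ x := by
  obtain ⟨-, r, hr, f, hf, rfl⟩ := hh
  have := hr.mul (measurable_nndiv_ratioSigma hf H.mem)
  simpa only [mul_div_assoc, Pi.mul_def] using this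

theorem exists_eq_comp_mul (H : IsPointedIsometry α μ₁ μ₂ D V f₀) {h : S₁ → ℝ≥0}
    (hh : h ∈ extRatioSpace α μ₁ D) :
    ∃ k : (D → ℝ≥0) → ℝ≥0, Measurable k ∧
      ∀ x, h x = k (ratioMap (fun f : D => f.1) f₀ x) * f₀ x := by
  obtain ⟨k, hk, h'⟩ := H.exists_eq_comp (H.measurable_div_of_mem_extRatioSpace hh)
  exact ⟨k, hk, fun x => by rw [← h', div_mul_cancel₀ _ (H.pos x).ne']⟩

theorem mem_extRatioSpace (H : IsPointedIsometry α μ₁ μ₂ D V f₀) {h : S₁ → ℝ≥0}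
    (hL : h ∈ LPlus α μ₁) {k : (D → ℝ≥0) → ℝ≥0} (hk : Measurable k)
    (hh : ∀ x, h x = k (ratioMap (fun f : D => f.1) f₀ x) * f₀ x) :
    h ∈ extRatioSpace α μ₁ D :=
  ⟨hL, _, hk.comp (measurable_ratioMap_ratioSigma (fun f : D => f.2) H.mem), f₀, H.mem,
    funext hh⟩

theorem subset_extRatioSpace (H : IsPointedIsometry α μ₁ μ₂ D V f₀) :
    D ⊆ extRatioSpace α μ₁ D := fun f hf =>
  ⟨H.subset hf, fun _ => 1, @measurable_const _ _ _ (_) 1, f, hf, by simp⟩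

theorem isMaxCone_extRatioSpace (H : IsPointedIsometry α μ₁ μ₂ D V f₀) :
    IsMaxCone (extRatioSpace α μ₁ D) := by
  intro h hh g hg a b _ _
  obtain ⟨k, hk, hk'⟩ := H.exists_eq_comp_mul hh
  obtain ⟨l, hl, hl'⟩ := H.exists_eq_comp_mul hg
  refine H.mem_extRatioSpace (LPlus.max_mem H.exponent_pos hh.1 hg.1 a b)
    ((hk.const_mul a).max (hl.const_mul b)) fun x => ?_
  rw [max_mul_of_nonneg _ _ zero_le, mul_assoc, mul_assoc, ← hk', ← hl']

theorem inducedMap_mem_extRatioSpace (H : IsPointedIsometry α μ₁ μ₂ D V f₀) {h : S₁ → ℝ≥0}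
    (hh : h ∈ extRatioSpace α μ₁ D) :
    inducedMap D V f₀ h ∈ extRatioSpace α μ₂ (V '' D) := by
  have hm := measurable_inducedFun (V := V) H.mem fun x => h x / f₀ x
  refine ⟨⟨?_, ?_⟩, _, hm, _, mem_image_of_mem V H.mem, rfl⟩
  · refine (hm.mono (ratioSigma_le ?_) le_rfl).mul (H.isometry.mapsTo _ H.mem).1
    rintro _ ⟨f, hf, rfl⟩
    exact (H.isometry.mapsTo f hf).1
  · obtain ⟨k, hk, hk'⟩ := H.exists_eq_comp_mul hh
    refine lt_of_eq_of_lt ?_ hh.1.2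
    simp_rw [hk']
    rw [← H.lintegral_comp_mul hk]
    refine lintegral_congr_ae ?_
    filter_upwards [H.inducedMap_ae_eq hk hk'] with t ht
    rw [ht]

theorem isMaxLinearIsometryOn_inducedMap (H : IsPointedIsometry α μ₁ μ₂ D V f₀) :
    IsMaxLinearIsometryOn α μ₁ μ₂ (extRatioSpace α μ₁ D) (inducedMap D V f₀) where
  mapsTo h hh := (H.inducedMap_mem_extRatioSpace hh).1
  map_max h hh g hg a b := by
    obtain ⟨k, hk, hk'⟩ := H.exists_eq_comp_mul hh
    obtain ⟨l, hl, hl'⟩ := H.exists_eq_comp_mul hg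
    have hmax := H.inducedMap_ae_eq (h := fun s => max (a * h s) (b * g s))
      ((hk.const_mul a).max (hl.const_mul b)) fun x => by
        rw [max_mul_of_nonneg _ _ zero_le, mul_assoc, mul_assoc, ← hk', ← hl']
    filter_upwards [hmax, H.inducedMap_ae_eq hk hk', H.inducedMap_ae_eq hl hl'] with t h1 h2 h3
    rw [h1, h2, h3, max_mul_of_nonneg _ _ zero_le, mul_assoc, mul_assoc]
  norm_eq h hh := by
    obtain ⟨k, hk, hk'⟩ := H.exists_eq_comp_mul hh
    unfold normPlus
    congr 1
    simp_rw [hk']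
    rw [← H.lintegral_comp_mul hk]
    refine lintegral_congr_ae ?_
    filter_upwards [H.inducedMap_ae_eq hk hk'] with t ht
    rw [ht]

theorem inducedMap_mul_ae_eq (H : IsPointedIsometry α μ₁ μ₂ D V f₀) {r : S₁ → ℝ≥0}
    (hr : Measurable[ratioSigma D] r) {f : S₁ → ℝ≥0} (hf : f ∈ D) :
    inducedMap D V f₀ (fun s => r s * f s) =ᵐ[μ₂] fun t => inducedFun D V f₀ r t * V f t := by
  obtain ⟨k, hk, hk'⟩ := H.exists_eq_comp hr
  have h1 := H.inducedMap_ae_eq (h := fun s => r s * f s)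
    (k := fun y => k y * y ⟨f, hf⟩) (hk.mul (measurable_pi_apply (⟨f, hf⟩ : D))) fun x => by
      rw [← hk', ratioMap, mul_assoc, div_mul_cancel₀ _ (H.pos x).ne']
  filter_upwards [h1, H.inducedFun_ae_eq hk hk', H.ae_eq_zero hf] with t h1 h2 h3
  rw [h1]
  by_cases h0 : V f₀ t = 0
  · simp [h0, h3 h0]
  · rw [h2 h0, mul_assoc]
    congr 1
    simp only [ratioMap]
    rw [div_mul_cancel₀ _ h0]

theorem inducedMap_ae_eq_self (H : IsPointedIsometry α μ₁ μ₂ D V f₀) {f : S₁ → ℝ≥0}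
    (hf : f ∈ D) : inducedMap D V f₀ f =ᵐ[μ₂] V f := by
  have h := H.inducedMap_ae_eq (h := f) (measurable_pi_apply (⟨f, hf⟩ : D)) fun x => by
    rw [ratioMap, div_mul_cancel₀ _ (H.pos x).ne']
  filter_upwards [h, H.ae_eq_zero hf] with t h1 h2
  rw [h1]
  by_cases h0 : V f₀ t = 0
  · simp [h0, h2 h0]
  · simp only [ratioMap]
    rw [div_mul_cancel₀ _ h0]

/-- An extension of `V` preserves the joint law of the ratios of all functions in the extended
ratio space, hence also the relation between `h / f₀` and the ratios of functions in `D`. -/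
theorem extension_ae_eq (H : IsPointedIsometry α μ₁ μ₂ D V f₀) {W : (S₁ → ℝ≥0) → (S₂ → ℝ≥0)}
    (hW : IsMaxLinearIsometryOn α μ₁ μ₂ (extRatioSpace α μ₁ D) W)
    (hWV : ∀ f ∈ D, W f =ᵐ[μ₂] V f) {h : S₁ → ℝ≥0} (hh : h ∈ extRatioSpace α μ₁ D) :
    W h =ᵐ[μ₂] inducedMap D V f₀ h := by
  classical
  -- replace `W` by a version that equals `V` everywhere on `D`
  set W' : (S₁ → ℝ≥0) → (S₂ → ℝ≥0) := fun f => if f ∈ D then V f else W f with hW'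
  have hae : ∀ f, W' f =ᵐ[μ₂] W f := by
    intro f
    by_cases hf : f ∈ D
    · simpa [hW', hf] using (hWV f hf).symm
    · simp [hW', hf]
  have hWD : ∀ f ∈ D, W' f = V f := fun f hf => if_pos hf
  have hiso : IsMaxLinearIsometryOn α μ₁ μ₂ (extRatioSpace α μ₁ D) W' := by
    refine ⟨fun f hf => ?_, fun f hf g hg a b => ?_, fun f hf => ?_⟩
    · by_cases hfD : f ∈ D
      · rw [hWD f hfD]
        exact H.isometry.mapsTo f hfD
      · simpa [hW', hfD] using hW.mapsTo f hf
    · filter_upwards [hae fun s => max (a * f s) (b * g s), hae f, hae g,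
        hW.map_max f hf g hg a b] with t h1 h2 h3 h4
      rw [h1, h2, h3, h4]
    · rw [← hW.norm_eq f hf]
      unfold normPlus
      congr 1
      refine lintegral_congr_ae ?_
      filter_upwards [hae f] with t ht
      rw [ht]
  have HE : IsPointedIsometry α μ₁ μ₂ (extRatioSpace α μ₁ D) W' f₀ :=
    ⟨H.exponent_pos, H.isMaxCone_extRatioSpace, fun f hf => hf.1, hiso,
      H.subset_extRatioSpace H.mem, H.pos⟩
  obtain ⟨k, hk, hk'⟩ := H.exists_eq_comp_mul hh
  have hmeas : MeasurableSet {x : extRatioSpace α μ₁ D → ℝ≥0 |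
      x ⟨h, hh⟩ = k fun f : D => x ⟨f.1, H.subset_extRatioSpace f.2⟩} :=
    measurableSet_eq_fun (measurable_pi_apply _)
      (hk.comp (measurable_pi_lambda _ fun f => measurable_pi_apply _))
  have key := (hiso.ae_ratioMap_iff HE.exponent_pos HE.cone HE.subset HE.mem HE.pos hmeas).2
    (Eventually.of_forall fun x => by
      show h x / f₀ x = k (ratioMap (fun f : D => f.1) f₀ x)
      rw [hk' x, mul_div_cancel_right₀ _ (H.pos x).ne'])
  filter_upwards [key, hae h, HE.ae_eq_zero hh, H.inducedMap_ae_eq hk hk'] with t h1 h2 h3 h4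
  rw [← h2, h4]
  by_cases h0 : V f₀ t = 0
  · rw [h3 (by rwa [hWD _ H.mem]), h0, mul_zero]
  · have h5 := h1 (by rwa [hWD _ H.mem])
    have h6 : W' h t / W' f₀ t = k fun f : D => W' f.1 t / W' f₀ t := h5
    simp only [hWD _ H.mem, hWD _ (Subtype.prop _)] at h6
    rw [div_eq_iff h0] at h6
    exact h6

theorem exists_inducedMap_ae_eq (H : IsPointedIsometry α μ₁ μ₂ D V f₀) {g : S₂ → ℝ≥0}
    (hg : g ∈ extRatioSpace α μ₂ (V '' D)) :
    ∃ h ∈ extRatioSpace α μ₁ D, inducedMap D V f₀ h =ᵐ[μ₂] g := by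
  obtain ⟨hL, q, hq, _, ⟨f, hf, rfl⟩, rfl⟩ := hg
  obtain ⟨k, hk, hk'⟩ := exists_eq_comp_ratioMap (G := fun f : D => V f.1)
    (by rintro _ ⟨f, hf, rfl⟩; exact ⟨⟨f, hf⟩, rfl⟩) (V f₀) hq
  have hkf : Measurable fun y : D → ℝ≥0 => k y * y ⟨f, hf⟩ :=
    hk.mul (measurable_pi_apply _)
  have hae : (fun t => k (ratioMap (fun f : D => V f.1) (V f₀) t) *
      ratioMap (fun f : D => V f.1) (V f₀) t ⟨f, hf⟩ * V f₀ t) =ᵐ[μ₂] fun t => q t * V f t := by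
    filter_upwards [H.ae_eq_zero hf] with t ht
    by_cases h0 : V f₀ t = 0
    · simp [h0, ht h0]
    · rw [hk' t h0, mul_assoc]
      congr 1
      simp only [ratioMap]
      rw [div_mul_cancel₀ _ h0]
  have hm : Measurable (ratioMap (fun f : D => f.1) f₀) :=
    measurable_ratioMap (fun f => (H.subset f.2).1) (H.subset H.mem).1
  refine ⟨_, H.mem_extRatioSpace ⟨(hkf.comp hm).mul (H.subset H.mem).1, ?_⟩ hkf fun x => rfl,
    (H.inducedMap_ae_eq hkf fun x => rfl).trans hae⟩
  refine lt_of_eq_of_lt (H.lintegral_comp_mul hkf).symm (lt_of_eq_of_lt ?_ hL.2)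
  refine lintegral_congr_ae ?_
  filter_upwards [hae] with t ht
  rw [ht]

/-! ### The set isomorphism -/

theorem isRegularSetIso_inducedSet (H : IsPointedIsometry α μ₁ μ₂ D V f₀) :
    IsRegularSetIso μ₁ μ₂ (ratioSigma D) (ratioSigma (V '' D)) (inducedSet D V f₀) where
  measurable A _ := (measurable_inducedFun H.mem _ (measurableSet_singleton 0)).compl
  compl A hA := by
    obtain ⟨C, hC, hAC⟩ := H.exists_eq_preimage hA
    rw [eventuallyEq_set]
    filter_upwards [H.inducedSet_ae hC hAC, H.inducedSet_univ_ae,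
      H.inducedSet_ae (A := Aᶜ) hC.compl fun x => not_congr (hAC x)] with t h1 h2 h3
    rw [Set.mem_sdiff, h1, h2, h3, mem_compl_iff]
    tauto
  iUnion A hA _ := by
    choose C hC hAC using fun n => H.exists_eq_preimage (hA n)
    rw [eventuallyEq_set]
    filter_upwards [ae_all_iff.2 fun n => H.inducedSet_ae (hC n) (hAC n),
      H.inducedSet_ae (A := ⋃ n, A n) (MeasurableSet.iUnion hC) fun x => by
        simp [mem_iUnion, hAC]] with t h1 h2
    rw [h2, mem_iUnion, mem_iUnion, ← exists_and_left]
    exact exists_congr fun n => (h1 n).symm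
  null_iff A hA := by
    obtain ⟨C, hC, hAC⟩ := H.exists_eq_preimage hA
    have h := H.isometry.ae_ratioMap_iff H.exponent_pos H.cone H.subset H.mem H.pos hC.compl
    rw [measure_eq_zero_iff_ae_notMem, measure_eq_zero_iff_ae_notMem]
    refine Iff.trans ?_ (h.trans (eventually_congr (Eventually.of_forall fun x => ?_)))
    · refine eventually_congr ((H.inducedSet_ae hC hAC).mono fun t ht => ?_)
      rw [ht, not_and]
      rfl
    · rw [hAC]
      rfl

theorem suppEq_image (H : IsPointedIsometry α μ₁ μ₂ D V f₀) :
    SuppEq μ₂ (V '' D) (inducedSet D V f₀ univ) := by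
  refine ⟨_, mem_image_of_mem V H.mem, ⟨(H.isometry.mapsTo _ H.mem).1, ?_⟩, ?_⟩
  · rintro _ ⟨f, hf, rfl⟩
    rw [measure_eq_zero_iff_ae_notMem]
    filter_upwards [H.ae_eq_zero hf] with t ht
    rintro ⟨h1, h2⟩
    exact h1 (ht (by simpa using h2))
  · rw [eventuallyEq_set]
    exact H.inducedSet_univ_ae

/-- On the support of `V f₀`, a set in `ρ(V(D))` is described by the ratios, and the same
description on the other side defines its preimage. -/
theorem isOntoTrace_inducedSet (H : IsPointedIsometry α μ₁ μ₂ D V f₀) :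
    IsOntoTrace μ₂ (ratioSigma D) (ratioSigma (V '' D)) (inducedSet D V f₀) := by
  intro B hB
  obtain ⟨k, hk, hk'⟩ := exists_eq_comp_ratioMap (G := fun f : D => V f.1)
    (by rintro _ ⟨f, hf, rfl⟩; exact ⟨⟨f, hf⟩, rfl⟩) (V f₀) (q := B.indicator 1)
    (measurable_indicator_one hB)
  have hC : MeasurableSet (k ⁻¹' {1}) := hk (measurableSet_singleton 1)
  refine ⟨ratioMap (fun f : D => f.1) f₀ ⁻¹' (k ⁻¹' {1}),
    measurable_ratioMap_ratioSigma (fun f : D => f.2) H.mem hC, ?_⟩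
  rw [eventuallyEq_set]
  filter_upwards [H.inducedSet_ae
    (A := ratioMap (fun f : D => f.1) f₀ ⁻¹' (k ⁻¹' {1})) hC fun x => Iff.rfl,
    H.inducedSet_univ_ae] with t h1 h2
  rw [h1, mem_inter_iff, h2, and_comm, and_congr_left_iff]
  intro h0
  rw [mem_preimage, ← hk' t h0, mem_singleton_iff]
  by_cases ht : t ∈ B <;> simp [ht]

theorem isInducedBy_inducedFun (H : IsPointedIsometry α μ₁ μ₂ D V f₀) {r : S₁ → ℝ≥0}
    (hr : Measurable[ratioSigma D] r) :
    IsInducedBy μ₂ (ratioSigma (V '' D)) (inducedSet D V f₀) r (inducedFun D V f₀ r) where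
  measurable := measurable_inducedFun H.mem r
  preimage B hB := by
    obtain ⟨k, hk, hk'⟩ := H.exists_eq_comp hr
    rw [eventuallyEq_set]
    filter_upwards [H.inducedFun_ae_eq hk hk', H.inducedSet_univ_ae,
      H.inducedSet_ae (A := r ⁻¹' B) (hk hB) fun x => by
        rw [mem_preimage, hk', mem_preimage]] with t h1 h2 h3
    rw [mem_inter_iff, h2, h3, and_comm, and_congr_right_iff]
    intro h0
    rw [mem_preimage, h1 h0, mem_preimage]
  zero_off := by
    filter_upwards [H.inducedSet_univ_ae] with t ht h
    exact inducedFun_eq_zero (not_not.1 (ht.not.1 h))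

theorem setLIntegral_eq (H : IsPointedIsometry α μ₁ μ₂ D V f₀) {f : S₁ → ℝ≥0} (hf : f ∈ D)
    {B : Set S₂} (hB : MeasurableSet[ratioSigma (V '' D)] B) {A : Set S₁}
    (hA : MeasurableSet[ratioSigma D] A)
    (hAB : (inducedSet D V f₀ A : Set S₂) =ᵐ[μ₂] (B ∩ inducedSet D V f₀ univ : Set S₂)) :
    ∫⁻ t in B, (V f t : ℝ≥0∞) ^ α ∂μ₂ = ∫⁻ s in A, (f s : ℝ≥0∞) ^ α ∂μ₁ := by
  have hA' : MeasurableSet A := ratioSigma_le (fun f hf => (H.subset hf).1) A hA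
  have hB' : MeasurableSet B := by
    refine ratioSigma_le (F := V '' D) ?_ B hB
    rintro _ ⟨f, hf, rfl⟩
    exact (H.isometry.mapsTo f hf).1
  obtain ⟨C, hC, hAC⟩ := H.exists_eq_preimage hA
  have h := H.lintegral_comp_mul ((measurable_pi_apply (⟨f, hf⟩ : D)).indicator hC)
  rw [← lintegral_indicator hA', ← lintegral_indicator hB']
  refine Eq.trans ?_ (h.trans ?_)
  · refine lintegral_congr_ae ?_
    filter_upwards [hAB.mem_iff, H.inducedSet_univ_ae, H.inducedSet_ae hC hAC,
      H.ae_eq_zero hf] with t h1 h2 h3 h4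
    by_cases h0 : V f₀ t = 0
    · simp [h0, h4 h0, H.exponent_pos]
    · rw [h3, mem_inter_iff, h2] at h1
      have h5 : t ∈ B ↔ ratioMap (fun f : D => V f.1) (V f₀) t ∈ C := by tauto
      by_cases hC' : ratioMap (fun f : D => V f.1) (V f₀) t ∈ C
      · rw [indicator_of_mem hC', indicator_of_mem (h5.2 hC')]
        simp only [ratioMap]
        rw [div_mul_cancel₀ _ h0]
      · rw [indicator_of_notMem hC', indicator_of_notMem (h5.not.2 hC'), zero_mul,
          ENNReal.coe_zero, ENNReal.zero_rpow_of_pos H.exponent_pos]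
  · refine lintegral_congr fun x => ?_
    by_cases hC' : ratioMap (fun f : D => f.1) f₀ x ∈ C
    · rw [indicator_of_mem hC', indicator_of_mem ((hAC x).2 hC')]
      simp only [ratioMap]
      rw [div_mul_cancel₀ _ (H.pos x).ne']
    · rw [indicator_of_notMem hC', indicator_of_notMem ((hAC x).not.2 hC'), zero_mul,
        ENNReal.coe_zero, ENNReal.zero_rpow_of_pos H.exponent_pos]

end IsPointedIsometry

/-! ### The extension theorem -/

/-- A function of full support can be modified on a null set so that it has no zeros. -/
theorem IsMaxLinearSubspace.exists_pos {F : Set (S → ℝ≥0)} (hF : IsMaxLinearSubspace α μ F)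
    (hsupp : SuppEq μ F univ) : ∃ f₀ ∈ F, ∀ s, 0 < f₀ s := by
  classical
  obtain ⟨f₁, hf₁, -, hu⟩ := hsupp
  have hL := hF.subset hf₁
  set f₀ : S → ℝ≥0 := fun s => if f₁ s = 0 then 1 else f₁ s with hf₀
  have hae : f₁ =ᵐ[μ] f₀ := by
    filter_upwards [hu.mem_iff] with s hs
    exact (if_neg (hs.1 (mem_univ s))).symm
  have hm : Measurable f₀ := Measurable.ite (hL.1 (measurableSet_singleton 0)) measurable_const hL.1
  refine ⟨f₀, hF.closed f₀ ⟨hm, ?_⟩ fun ε hε => ⟨f₁, hf₁, ?_⟩, fun s => ?_⟩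
  · refine lt_of_eq_of_lt (lintegral_congr_ae ?_) hL.2
    filter_upwards [hae] with s hs
    rw [hs]
  · refine lt_of_eq_of_lt ?_ hε
    rw [distPlus, ← lintegral_zero (μ := μ)]
    refine lintegral_congr_ae ?_
    filter_upwards [hae] with s hs
    simp [hs]
  · by_cases h : f₁ s = 0
    · simp [hf₀, h]
    · simpa [hf₀, h] using pos_iff_ne_zero.2 h

end

theorem theorem3p2 {S₁ S₂ : Type*} [MeasurableSpace S₁] [MeasurableSpace S₂]
    (μ₁ : Measure S₁) (μ₂ : Measure S₂) [SigmaFinite μ₁] (α : ℝ) (hα : 0 < α)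
    (F : Set (S₁ → ℝ≥0)) (hF : IsMaxLinearSubspace α μ₁ F) (hsupp : SuppEq μ₁ F univ)
    (U : (S₁ → ℝ≥0) → (S₂ → ℝ≥0)) (hU : IsMaxLinearIsometryOn α μ₁ μ₂ F U) :
    ∃ (Ubar : (S₁ → ℝ≥0) → (S₂ → ℝ≥0)) (T : Set S₁ → Set S₂)
      (Tfun : (S₁ → ℝ≥0) → (S₂ → ℝ≥0)),
      -- `Ubar` is a max-linear isometry on the extended positive ratio space, extending `U`
      IsMaxLinearIsometryOn α μ₁ μ₂ (extRatioSpace α μ₁ F) Ubar ∧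
      (∀ f ∈ F, Ubar f =ᵐ[μ₂] U f) ∧
      -- it is the only one
      (∀ V : (S₁ → ℝ≥0) → (S₂ → ℝ≥0),
        IsMaxLinearIsometryOn α μ₁ μ₂ (extRatioSpace α μ₁ F) V →
        (∀ f ∈ F, V f =ᵐ[μ₂] U f) →
        ∀ h ∈ extRatioSpace α μ₁ F, V h =ᵐ[μ₂] Ubar h) ∧
      -- it maps onto the extended positive ratio space of `U(F)`
      (∀ h ∈ extRatioSpace α μ₁ F, ∃ g ∈ extRatioSpace α μ₂ (U '' F), Ubar h =ᵐ[μ₂] g) ∧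
      (∀ g ∈ extRatioSpace α μ₂ (U '' F), ∃ h ∈ extRatioSpace α μ₁ F, Ubar h =ᵐ[μ₂] g) ∧
      -- `T` is a regular set isomorphism of `ρ(F)` onto `ρ(U(F))` on `supp(U(F))`
      IsRegularSetIso μ₁ μ₂ (ratioSigma F) (ratioSigma (U '' F)) T ∧
      SuppEq μ₂ (U '' F) (T univ) ∧
      IsOntoTrace μ₂ (ratioSigma F) (ratioSigma (U '' F)) T ∧
      -- `Tfun` is the function map induced by `T`, and `Ubar (r f) = (T r) (U f)`
      (∀ r : S₁ → ℝ≥0, Measurable[ratioSigma F] r →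
        IsInducedBy μ₂ (ratioSigma (U '' F)) T r (Tfun r)) ∧
      (∀ r : S₁ → ℝ≥0, Measurable[ratioSigma F] r → ∀ f ∈ F,
        (fun s => r s * f s) ∈ LPlus α μ₁ →
        Ubar (fun s => r s * f s) =ᵐ[μ₂] fun t => Tfun r t * U f t) ∧
      -- `(U f)^α dμ₂ = (f^α dμ₁) ∘ T⁻¹` on `ρ(U(F))`
      (∀ f ∈ F, ∀ B, MeasurableSet[ratioSigma (U '' F)] B →
        ∀ A, MeasurableSet[ratioSigma F] A → (T A : Set S₂) =ᵐ[μ₂] (B ∩ T univ : Set S₂) →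
        ∫⁻ t in B, (U f t : ℝ≥0∞) ^ α ∂μ₂ = ∫⁻ s in A, (f s : ℝ≥0∞) ^ α ∂μ₁) := by
  obtain ⟨f₀, hf₀, hpos⟩ := hF.exists_pos hsupp
  have H : IsPointedIsometry α μ₁ μ₂ F U f₀ :=
    ⟨hα, hF.max_mem, hF.subset, hU, hf₀, hpos⟩
  exact ⟨inducedMap F U f₀, inducedSet F U f₀, inducedFun F U f₀,
    H.isMaxLinearIsometryOn_inducedMap, fun f hf => H.inducedMap_ae_eq_self hf,
    fun W hW hWU h hh => H.extension_ae_eq hW hWU hh,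
    fun h hh => ⟨_, H.inducedMap_mem_extRatioSpace hh, Filter.EventuallyEq.rfl⟩,
    fun g hg => H.exists_inducedMap_ae_eq hg,
    H.isRegularSetIso_inducedSet, H.suppEq_image, H.isOntoTrace_inducedSet,
    fun r hr => H.isInducedBy_inducedFun hr,
    fun r hr f hf _ => H.inducedMap_mul_ae_eq hr hf,
    fun f hf B hB A hA hAB => H.setLIntegral_eq hf hB hA hAB⟩
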